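/- Let $H(2,1)$ be the generalized Heisenberg group of real matrices $$a=\begin{pmatrix}1&A&c\\0&I_2&{}^tB\\0&0&1\end{pmatrix},\qquad A=(x^1,x^2),\ B=(y^1,y^2)\in\mathbb R^2,\ c=z\in\mathbb R,$$ with global coordinates $(x^1,x^2,y^1,y^2,z)$. For $i=1,2$ put $$X_i=2\frac{\partial}{\partial x^i},\quad Y_i=2\Big(\frac{\partial}{\partial y^i}+x^i\frac{\partial}{\partial z}\Big),\quad \xi=2\frac{\partial}{\partial z},\quad \eta=\tfrac12\,(dz-x^1dy^1-x^2dy^2),$$ $$g=\tfrac14\,(dx^1\otimes dx^1+dx^2\otimes dx^2+dy^1\otimes dy^1+dy^2\otimes dy^2)+\eta\otimes\eta ,$$ and, for $\theta\in\mathbb R$, let $\varphi$ be the $(1,1)$-tensor field with $\varphi\xi=0$ and $$\varphi X_1=\cos\theta\,Y_1+\sin\theta\,Y_2,\qquad \varphi X_2=\sin\theta\,Y_1-\cos\theta\,Y_2,$$ $$\varphi Y_1=-\cos\theta\,X_1-\sin\theta\,X_2,\qquad \varphi Y_2=-\sin\theta\,X_1+\cos\theta\,X_2 .$$ Let $R_{XY}Z=\nabla_X\nabla_YZ-\nabla_Y\nabla_XZ-\nabla_{[X,Y]}Z$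 be the curvature of the Levi-Civita connection of $g$ and $R(X,Y,Z,W)=-g(R_{XY}Z,W)$. Then for every $\theta\in\mathbb R$: 1. $g$ is a left-invariant Riemannian metric on $H(2,1)$, and $(\varphi,\xi,\eta,g)$ is an almost contact metric structure, that is, $\varphi^2=-I+\eta\otimes\xi$, $\eta(\xi)=1$ and $g(\varphi X,\varphi Y)=g(X,Y)-\eta(X)\eta(Y)$. 2. The structure is K-contact in the following sense: $\eta$ is a contact form ($\eta\wedge(d\eta)^2\ne0$ everywhere), $\xi$ is its characteristic vector field ($\eta(\xi)=1$, $i_\xi d\eta=0$), and $\xi$ is a Killing vector field of $g$. (The compatibility $d\eta(X,Y)=g(X,\varphi Y)$ is not part of this notion.) 3. The structure is not Sasakian, i.e. it is not a normal contact metric structure: it is not true that both $d\eta(X,Y)=g(X,\varphi Y)$ and $[\varphi,\varphi]+2\,d\eta\otimes\xi=0$ hold, where $2\,d\eta(X,Y)=X(\eta(Y))-Y(\eta(X))-\eta([X,Y])$. 4. The identity (G2) holds: for all vector fields $X,Y,Z,W$, $$\begin{aligned}R(X,Y,Z,W)={}&R(\varphi X,Y,Z,\varphi W)+R(X,\varphi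 Y,Z,\varphi W)+R(X,Y,\varphi Z,\varphi W)\\&+g(X,Z)\eta(W)\eta(Y)-g(Z,Y)\eta(X)\eta(W).\end{aligned}$$ 5. The identity (G1) fails: it is not true that for all vector fields $X,Y,Z,W$, $$\begin{aligned}R(X,Y,\varphi Z,\varphi W)-R(X,Y,Z,W)={}&g(Y,\varphi W)g(X,\varphi Z)-g(X,\varphi W)g(Y,\varphi Z)\\&+g(X,W)g(Y,Z)-g(Y,W)g(X,Z).\end{aligned}$$ -/

import Mathlib

open scoped ContDiff

noncomputable section

/-! ### Riemannian geometry in a global chart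

A manifold diffeomorphic to `ℝⁿ` is described in a global coordinate system `(x⁰, …, xⁿ⁻¹)`:
points and tangent vectors are both elements of `Fin n → ℝ`, and tensor fields are functions of the
point. -/

/-- The coordinate space `ℝⁿ`. Only its structure as a topological vector space is used; all
metric notions come from the tensor field `g`. -/
abbrev Coord (n : ℕ) : Type := Fin n → ℝ

/-- Vector fields. -/
abbrev VField (n : ℕ) : Type := Coord n → Coord n

/-- Fields of `1`-forms. -/
abbrev OneForm (n : ℕ) : Type := Coord n → (Coord n →L[ℝ] ℝ)

/-- Fields of `(1,1)`-tensors. -/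
abbrev EndField (n : ℕ) : Type := Coord n → (Coord n →L[ℝ] Coord n)

/-- Fields of bilinear forms. -/
abbrev BilinField (n : ℕ) : Type := Coord n → (Coord n →L[ℝ] Coord n →L[ℝ] ℝ)

/-- `g` is a (smooth) Riemannian metric. -/
structure IsRiemannianMetric {n : ℕ} (g : BilinField n) : Prop where
  smooth : ContDiff ℝ ∞ g
  symm : ∀ p v w, g p v w = g p w v
  pos : ∀ p v, v ≠ 0 → 0 < g p v v

/-- The coordinate vector `∂/∂xⁱ`. -/
def partialVec {n : ℕ} (i : Fin n) : Coord n := Pi.single i 1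

/-- The Gram matrix `(g_ij)` of `g` in the coordinates. -/
def gramMatrix {n : ℕ} (g : BilinField n) (p : Coord n) : Matrix (Fin n) (Fin n) ℝ :=
  Matrix.of fun i j => g p (partialVec i) (partialVec j)

/-- The partial derivative `∂_k g_ij`. -/
def gramDeriv {n : ℕ} (g : BilinField n) (p : Coord n) (k i j : Fin n) : ℝ :=
  fderiv ℝ (fun q => gramMatrix g q i j) p (partialVec k)

/-- The Christoffel symbols `Γᵏ_ij = ½ ∑ₗ gᵏˡ (∂_i g_jl + ∂_j g_il - ∂_l g_ij)`. -/
def christoffel {n : ℕ} (g : BilinField n) (p : Coord n) (k i j : Fin n) : ℝ :=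
  (1 / 2 : ℝ) * ∑ l, (gramMatrix g p)⁻¹ k l *
    (gramDeriv g p i j l + gramDeriv g p j i l - gramDeriv g p l i j)

/-- The Levi-Civita connection `∇_X Y`, `(∇_X Y)ᵏ = X(Yᵏ) + ∑ᵢⱼ Γᵏ_ij Xⁱ Yʲ`. -/
def levi {n : ℕ} (g : BilinField n) (X Y : VField n) : VField n := fun p k =>
  fderiv ℝ Y p (X p) k + ∑ i, ∑ j, christoffel g p k i j * X p i * Y p j

/-- The curvature `R_{XY} Z = ∇_X ∇_Y Z - ∇_Y ∇_X Z - ∇_{[X,Y]} Z`. -/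
def curv {n : ℕ} (g : BilinField n) (X Y Z : VField n) : VField n :=
  levi g X (levi g Y Z) - levi g Y (levi g X Z) - levi g (VectorField.lieBracket ℝ X Y) Z

/-- The Riemann-Christoffel tensor `R(X,Y,Z,W) = - g(R_{XY} Z, W)`. -/
def riem {n : ℕ} (g : BilinField n) (X Y Z W : VField n) (p : Coord n) : ℝ :=
  - g p (curv g X Y Z p) (W p)

/-- `ξ` is a Killing field: `(L_ξ g)(X,Y) = ξ(g(X,Y)) - g([ξ,X],Y) - g(X,[ξ,Y]) = 0`. -/
def IsKilling {n : ℕ} (g : BilinField n) (ξ : VField n) : Prop :=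
  ∀ X Y : VField n, ContDiff ℝ ∞ X → ContDiff ℝ ∞ Y → ∀ p,
    fderiv ℝ (fun q => g q (X q) (Y q)) p (ξ p)
      - g p (VectorField.lieBracket ℝ ξ X p) (Y p)
      - g p (X p) (VectorField.lieBracket ℝ ξ Y p) = 0

/-! ### Contact forms and almost contact metric structures -/

/-- `X(η(Y)) - Y(η(X)) - η([X,Y])` as a pointwise bilinear expression, i.e. the exterior derivative
of `η` normalised without the factor `1/2`. -/
def extD {n : ℕ} (η : OneForm n) (p v w : Coord n) : ℝ :=
  fderiv ℝ η p v w - fderiv ℝ η p w v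

/-- The value of `η ∧ (dη)^m` at `p` on `2m+1` vectors, up to a positive constant depending only
on `m` and on the normalisation of the wedge product. -/
def contactVolume {n : ℕ} (η : OneForm n) (m : ℕ) (p : Coord n)
    (v : Fin (2 * m + 1) → Coord n) : ℝ :=
  ∑ σ : Equiv.Perm (Fin (2 * m + 1)), ((Equiv.Perm.sign σ : ℤ) : ℝ) *
    (η p (v (σ 0)) * ∏ i : Fin m,
      extD η p (v (σ ⟨2 * i.1 + 1, by omega⟩)) (v (σ ⟨2 * i.1 + 2, by omega⟩)))

/-- `η` is a contact form on an odd-dimensional space: `η ∧ (dη)^m` vanishes nowhere,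
where `n = 2m+1`. -/
def IsContactForm {n : ℕ} (η : OneForm n) : Prop :=
  ContDiff ℝ ∞ η ∧ ∃ m, n = 2 * m + 1 ∧ ∀ p, ∃ v, contactVolume η m p v ≠ 0

/-- The data `(φ, ξ, η, g)` of an almost contact metric structure in a global chart. -/
structure ContactData (n : ℕ) where
  φ : EndField n
  ξ : VField n
  η : OneForm n
  g : BilinField n

namespace ContactData

variable {n : ℕ} (S : ContactData n)

/-- The vector field `φX`. -/
def phi (X : VField n) : VField n := fun p => S.φ p (X p)

/-- `(φ, ξ, η, g)` is an almost contact metric structure: `φ² = -I + η ⊗ ξ`, `η(ξ) = 1` and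
`g(φX, φY) = g(X,Y) - η(X)η(Y)`, with `g` a Riemannian metric and all the tensors smooth. -/
structure IsAlmostContactMetric : Prop where
  smooth_φ : ContDiff ℝ ∞ S.φ
  smooth_ξ : ContDiff ℝ ∞ S.ξ
  smooth_η : ContDiff ℝ ∞ S.η
  metric : IsRiemannianMetric S.g
  phi_sq : ∀ p v, S.φ p (S.φ p v) = -v + S.η p v • S.ξ p
  eta_xi : ∀ p, S.η p (S.ξ p) = 1
  compat : ∀ p v w, S.g p (S.φ p v) (S.φ p w) = S.g p v w - S.η p v * S.η p w

/-- K-contact: `η` is a contact form, `ξ` is its characteristic (Reeb) vector field, and `ξ` is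
a Killing field. -/
structure IsKContact : Prop where
  almostContactMetric : S.IsAlmostContactMetric
  contact : IsContactForm S.η
  reeb : ∀ p v, extD S.η p (S.ξ p) v = 0
  killing : IsKilling S.g S.ξ

/-- The contact metric condition `dη(X,Y) = g(X, φY)`, where
`2 dη(X,Y) = X(η(Y)) - Y(η(X)) - η([X,Y])`. -/
def IsContactMetric : Prop :=
  S.IsAlmostContactMetric ∧ ∀ p v w, (1 / 2 : ℝ) * extD S.η p v w = S.g p v (S.φ p w)

/-- The Nijenhuis torsion `[φ,φ](X,Y) = φ²[X,Y] + [φX,φY] - φ[φX,Y] - φ[X,φY]`. -/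
def nijenhuis (X Y : VField n) (p : Coord n) : Coord n :=
  S.φ p (S.φ p (VectorField.lieBracket ℝ X Y p))
    + VectorField.lieBracket ℝ (S.phi X) (S.phi Y) p
    - S.φ p (VectorField.lieBracket ℝ (S.phi X) Y p)
    - S.φ p (VectorField.lieBracket ℝ X (S.phi Y) p)

/-- Normality `[φ,φ] + 2 dη ⊗ ξ = 0`, with `dη` normalised as in `IsContactMetric`. -/
def IsNormal : Prop :=
  ∀ X Y : VField n, ContDiff ℝ ∞ X → ContDiff ℝ ∞ Y → ∀ p,
    S.nijenhuis X Y p + extD S.η p (X p) (Y p) • S.ξ p = 0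

/-- Sasakian: a normal contact metric structure. -/
def IsSasakian : Prop := S.IsContactMetric ∧ S.IsNormal

/-- The curvature identity (G1). -/
def G1 : Prop :=
  ∀ X Y Z W : VField n, ContDiff ℝ ∞ X → ContDiff ℝ ∞ Y → ContDiff ℝ ∞ Z → ContDiff ℝ ∞ W →
    ∀ p, riem S.g X Y (S.phi Z) (S.phi W) p - riem S.g X Y Z W p =
      S.g p (Y p) (S.phi W p) * S.g p (X p) (S.phi Z p)
        - S.g p (X p) (S.phi W p) * S.g p (Y p) (S.phi Z p)
        + S.g p (X p) (W p) * S.g p (Y p) (Z p)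
        - S.g p (Y p) (W p) * S.g p (X p) (Z p)

/-- The curvature identity (G2). -/
def G2 : Prop :=
  ∀ X Y Z W : VField n, ContDiff ℝ ∞ X → ContDiff ℝ ∞ Y → ContDiff ℝ ∞ Z → ContDiff ℝ ∞ W →
    ∀ p, riem S.g X Y Z W p =
      riem S.g (S.phi X) Y Z (S.phi W) p
        + riem S.g X (S.phi Y) Z (S.phi W) p
        + riem S.g X Y (S.phi Z) (S.phi W) p
        + S.g p (X p) (Z p) * S.η p (W p) * S.η p (Y p)
        - S.g p (Z p) (Y p) * S.η p (X p) * S.η p (W p)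

end ContactData

/-! ### The generalized Heisenberg group `H(2,1)` -/

/-- The matrix with rows `(1, A, c)`, `(0, I₂, ᵗB)`, `(0, 0, 1)`, where
`A = (x¹, x²)`, `B = (y¹, y²)`, `c = z` and `p = (x¹, x², y¹, y², z)`. -/
def heisMatrix (p : Coord 5) : Matrix (Fin 4) (Fin 4) ℝ :=
  !![1, p 0, p 1, p 4;
     0, 1,   0,   p 2;
     0, 0,   1,   p 3;
     0, 0,   0,   1]

theorem heisMatrix_mul (p q : Coord 5) : heisMatrix p * heisMatrix q =
    heisMatrix ![p 0 + q 0, p 1 + q 1, p 2 + q 2, p 3 + q 3,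
      p 4 + q 4 + p 0 * q 2 + p 1 * q 3] := by
  ext i j
  fin_cases i <;> fin_cases j <;>
    simp [heisMatrix, Matrix.mul_apply, Fin.sum_univ_four] <;> ring

theorem heisMatrix_zero : heisMatrix 0 = 1 := by
  ext i j
  fin_cases i <;> fin_cases j <;> simp [heisMatrix]

/-- Coordinates of the inverse matrix. -/
def heisInv (p : Coord 5) : Coord 5 :=
  ![-p 0, -p 1, -p 2, -p 3, -p 4 + p 0 * p 2 + p 1 * p 3]

theorem heisMatrix_mul_inv (p : Coord 5) : heisMatrix p * heisMatrix (heisInv p) = 1 := by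
  rw [heisMatrix_mul, ← heisMatrix_zero]
  congr 1
  ext i
  fin_cases i <;> simp [heisInv] <;> ring

theorem heisMatrix_inv_mul (p : Coord 5) : heisMatrix (heisInv p) * heisMatrix p = 1 := by
  rw [heisMatrix_mul, ← heisMatrix_zero]
  congr 1
  ext i
  fin_cases i <;> simp [heisInv] <;> ring

/-- `heisMatrix p` as an invertible matrix. -/
def heisUnit (p : Coord 5) : (Matrix (Fin 4) (Fin 4) ℝ)ˣ :=
  ⟨heisMatrix p, heisMatrix (heisInv p), heisMatrix_mul_inv p, heisMatrix_inv_mul p⟩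

/-- The generalized Heisenberg group `H(2,1)`, as a group of matrices. -/
def H21 : Subgroup (Matrix (Fin 4) (Fin 4) ℝ)ˣ where
  carrier := Set.range heisUnit
  mul_mem' := by
    rintro _ _ ⟨p, rfl⟩ ⟨q, rfl⟩
    exact ⟨_, Units.ext (heisMatrix_mul p q).symm⟩
  one_mem' := ⟨0, Units.ext heisMatrix_zero⟩
  inv_mem' := by
    rintro _ ⟨p, rfl⟩
    exact ⟨heisInv p, Units.ext rfl⟩

/-- The global coordinates `(x¹, x², y¹, y², z)` on `H(2,1)`. -/
def heisCoord : H21 ≃ Coord 5 where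
  toFun a := ![a.1.1 0 1, a.1.1 0 2, a.1.1 1 3, a.1.1 2 3, a.1.1 0 3]
  invFun p := ⟨heisUnit p, p, rfl⟩
  left_inv := by
    rintro ⟨_, p, rfl⟩
    apply Subtype.ext
    apply Units.ext
    ext i j
    fin_cases i <;> fin_cases j <;> simp [heisUnit, heisMatrix]
  right_inv p := by
    ext i
    fin_cases i <;> simp [heisUnit, heisMatrix]

/-- The left translation by `a`, read in the global coordinates. -/
def leftTranslation (a : H21) (p : Coord 5) : Coord 5 := heisCoord (a * heisCoord.symm p)

/-- A metric on `H(2,1)` is left invariant: every left translation is an isometry. -/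
def IsLeftInvariantMetric (g : BilinField 5) : Prop :=
  ∀ (a : H21) (p v w : Coord 5),
    g (leftTranslation a p) (fderiv ℝ (leftTranslation a) p v) (fderiv ℝ (leftTranslation a) p w)
      = g p v w

/-- The coordinate `1`-form `dxⁱ`; here `dx 0, dx 1, dx 2, dx 3, dx 4` are
`dx¹, dx², dy¹, dy², dz`. -/
def dx (i : Fin 5) : Coord 5 →L[ℝ] ℝ := ContinuousLinearMap.proj i

/-- `X₁ = 2 ∂/∂x¹`. -/
def heisX₁ : VField 5 := fun _ => (2 : ℝ) • partialVec 0

/-- `X₂ = 2 ∂/∂x²`. -/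
def heisX₂ : VField 5 := fun _ => (2 : ℝ) • partialVec 1

/-- `Y₁ = 2 (∂/∂y¹ + x¹ ∂/∂z)`. -/
def heisY₁ : VField 5 := fun p => (2 : ℝ) • (partialVec 2 + p 0 • partialVec 4)

/-- `Y₂ = 2 (∂/∂y² + x² ∂/∂z)`. -/
def heisY₂ : VField 5 := fun p => (2 : ℝ) • (partialVec 3 + p 1 • partialVec 4)

/-- `ξ = 2 ∂/∂z`. -/
def heisξ : VField 5 := fun _ => (2 : ℝ) • partialVec 4

/-- `η = ½ (dz - x¹ dy¹ - x² dy²)`. -/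
def heisη : OneForm 5 := fun p => (1 / 2 : ℝ) • (dx 4 - p 0 • dx 2 - p 1 • dx 3)

/-- `g = ¼ (dx¹ ⊗ dx¹ + dx² ⊗ dx² + dy¹ ⊗ dy¹ + dy² ⊗ dy²) + η ⊗ η`. -/
def heisg : BilinField 5 := fun p =>
  (1 / 4 : ℝ) • ((dx 0).smulRight (dx 0) + (dx 1).smulRight (dx 1)
      + (dx 2).smulRight (dx 2) + (dx 3).smulRight (dx 3))
    + (heisη p).smulRight (heisη p)

/-- The endomorphism field with `φX₁ = cos θ Y₁ + sin θ Y₂`, `φX₂ = sin θ Y₁ - cos θ Y₂`,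
`φY₁ = - cos θ X₁ - sin θ X₂`, `φY₂ = - sin θ X₁ + cos θ X₂` and `φξ = 0`. It is written with the
frame `½dx¹, ½dx², ½dy¹, ½dy², η` dual to `X₁, X₂, Y₁, Y₂, ξ`. -/
def heisφ (θ : ℝ) : EndField 5 := fun p =>
  ((1 / 2 : ℝ) • dx 0).smulRight (Real.cos θ • heisY₁ p + Real.sin θ • heisY₂ p)
    + ((1 / 2 : ℝ) • dx 1).smulRight (Real.sin θ • heisY₁ p - Real.cos θ • heisY₂ p)
    + ((1 / 2 : ℝ) • dx 2).smulRight (-(Real.cos θ • heisX₁ p) - Real.sin θ • heisX₂ p)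
    + ((1 / 2 : ℝ) • dx 3).smulRight (-(Real.sin θ • heisX₁ p) + Real.cos θ • heisX₂ p)

/-- The structure `(φ, ξ, η, g)` on `H(2,1)` with parameter `θ`. -/
def heisStructure (θ : ℝ) : ContactData 5 where
  φ := heisφ θ
  ξ := heisξ
  η := heisη
  g := heisg

theorem heisφ_X₁ (θ : ℝ) (p : Coord 5) :
    heisφ θ p (heisX₁ p) = Real.cos θ • heisY₁ p + Real.sin θ • heisY₂ p := by
  simp [heisφ, heisX₁, dx, partialVec]

theorem heisφ_X₂ (θ : ℝ) (p : Coord 5) :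
    heisφ θ p (heisX₂ p) = Real.sin θ • heisY₁ p - Real.cos θ • heisY₂ p := by
  simp [heisφ, heisX₂, dx, partialVec]

theorem heisφ_Y₁ (θ : ℝ) (p : Coord 5) :
    heisφ θ p (heisY₁ p) = -(Real.cos θ • heisX₁ p) - Real.sin θ • heisX₂ p := by
  simp [heisφ, heisY₁, dx, partialVec]

theorem heisφ_Y₂ (θ : ℝ) (p : Coord 5) :
    heisφ θ p (heisY₂ p) = -(Real.sin θ • heisX₁ p) + Real.cos θ • heisX₂ p := by
  simp [heisφ, heisY₂, dx, partialVec]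

theorem heisφ_ξ (θ : ℝ) (p : Coord 5) : heisφ θ p (heisξ p) = 0 := by
  simp [heisφ, heisξ, dx, partialVec]

end

/-! Since `g` is a constant form plus `η ⊗ η`, the Koszul formula can be solved by hand: `∇ - D` is
an explicit polynomial tensor `heisConn`, and no Gram matrix is inverted. The curvature `riem_heisg`
then involves only `g`, `η` and `Ω = extD η`.

On `ker η`, `φ` sends the `X`-plane to the `Y`-plane by a symmetric orthogonal matrix `S` and comes
back by `-S`. Symmetry and `S² = 1` make `φ` skew for `Ω` and make it preserve `Ω`; with
`riem_heisg` this gives (G2). The contact metric condition would force `S = 1`, but `S` is a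
reflection: trace zero refutes Sasakian, and determinant `-1` flips a sign in (G1). Neither depends
on `θ`. -/

/-! ### Christoffel symbols and curvature from a connection form -/

section General

variable {n : ℕ}

/-- A function that is quadratic along the line through `p` in direction `x` has the linear
coefficient as its derivative. -/
theorem fderiv_eq_of_quadratic {E F : Type*} [NormedAddCommGroup E] [NormedSpace ℝ E]
    [NormedAddCommGroup F] [NormedSpace ℝ F] {f : E → F} {p x : E} {b c : F}
    (hf : DifferentiableAt ℝ f p) (h : ∀ t : ℝ, f (p + t • x) = f p + t • b + t ^ 2 • c) :
    fderiv ℝ f p x = b := by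
  have h1 : HasDerivAt (fun t : ℝ => f (p + t • x)) (fderiv ℝ f p x) 0 := by
    have hl : HasDerivAt (fun t : ℝ => p + t • x) x 0 := by
      simpa using ((hasDerivAt_id (0 : ℝ)).smul_const x).const_add p
    have hf' : HasFDerivAt f (fderiv ℝ f p) (p + (0 : ℝ) • x) := by
      simpa using hf.hasFDerivAt
    exact hf'.comp_hasDerivAt 0 hl
  have h2 : HasDerivAt (fun t : ℝ => f (p + t • x)) b 0 := by
    simp_rw [h]
    have h3 := (((hasDerivAt_id (0 : ℝ)).smul_const b).const_add (f p)).add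
      (((hasDerivAt_id (0 : ℝ)).pow 2).smul_const c)
    exact h3.congr_deriv (by simp)
  exact h1.unique h2

theorem sum_smul_partialVec (v : Coord n) : ∑ i, v i • partialVec i = v := by
  ext k
  simp [partialVec, Finset.sum_apply, Pi.single_apply]

theorem dotProduct_gramMatrix_mulVec (g : BilinField n) (p v w : Coord n) :
    v ⬝ᵥ (gramMatrix g p).mulVec w = g p v w := by
  conv_rhs => rw [← sum_smul_partialVec v, ← sum_smul_partialVec w]
  simp [gramMatrix, dotProduct, Matrix.mulVec, Finset.mul_sum]
  rw [Finset.sum_comm]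
  exact Finset.sum_congr rfl fun i _ => Finset.sum_congr rfl fun j _ => by ring

theorem gramMatrix_mulVec_apply (g : BilinField n) (p w : Coord n) (i : Fin n) :
    (gramMatrix g p).mulVec w i = g p (partialVec i) w := by
  rw [← dotProduct_gramMatrix_mulVec, partialVec, single_one_dotProduct]

/-- A kernel vector `v` of the Gram matrix satisfies `g(v, v) = 0`, so positivity forces `v = 0`. -/
theorem IsRiemannianMetric.isUnit_gramMatrix {g : BilinField n} (hg : IsRiemannianMetric g)
    (p : Coord n) : IsUnit (gramMatrix g p) := by
  rw [← Matrix.mulVec_injective_iff_isUnit]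
  refine (injective_iff_map_eq_zero (gramMatrix g p).mulVecLin).2 fun v hv => ?_
  by_contra hne
  have h := hg.pos p v hne
  rw [← dotProduct_gramMatrix_mulVec] at h
  rw [Matrix.mulVecLin_apply] at hv
  simp [hv] at h

theorem gramDeriv_eq {g : BilinField n} {p : Coord n} (hg : DifferentiableAt ℝ g p)
    (k i j : Fin n) :
    gramDeriv g p k i j = fderiv ℝ g p (partialVec k) (partialVec i) (partialVec j) := by
  have h : HasFDerivAt (fun q => g q (partialVec i) (partialVec j)) _ p :=
    (hg.hasFDerivAt.clm_apply (hasFDerivAt_const _ _)).clm_apply (hasFDerivAt_const _ _)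
  simp only [gramDeriv, gramMatrix, Matrix.of_apply]
  rw [h.fderiv]
  simp

/-- The Christoffel symbols are determined by the Koszul formula. -/
theorem IsRiemannianMetric.christoffel_eq {g : BilinField n} (hg : IsRiemannianMetric g)
    {p : Coord n} {B : Coord n →L[ℝ] Coord n →L[ℝ] Coord n}
    (hB : ∀ v w u, 2 * g p (B v w) u
      = fderiv ℝ g p v w u + fderiv ℝ g p w v u - fderiv ℝ g p u v w) (k i j : Fin n) :
    christoffel g p k i j = B (partialVec i) (partialVec j) k := by
  have hd : DifferentiableAt ℝ g p := hg.smooth.differentiable (by simp) p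
  -- By Koszul the derivative terms form the Gram matrix applied to `2 B(∂ᵢ, ∂ⱼ)`, so its inverse
  -- cancels without being computed.
  have hk : ∀ l, gramDeriv g p i j l + gramDeriv g p j i l - gramDeriv g p l i j
      = 2 * (gramMatrix g p).mulVec (B (partialVec i) (partialVec j)) l := by
    intro l
    rw [gramDeriv_eq hd, gramDeriv_eq hd, gramDeriv_eq hd, gramMatrix_mulVec_apply, hg.symm, hB]
  have hinv : (gramMatrix g p)⁻¹ * gramMatrix g p = 1 :=
    Matrix.nonsing_inv_mul _ ((Matrix.isUnit_iff_isUnit_det _).1 (hg.isUnit_gramMatrix p))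
  calc christoffel g p k i j
      = ((gramMatrix g p)⁻¹.mulVec
          ((gramMatrix g p).mulVec (B (partialVec i) (partialVec j)))) k := by
        simp only [christoffel, hk]
        rw [Matrix.mulVec, dotProduct, Finset.mul_sum]
        exact Finset.sum_congr rfl fun l _ => by ring
    _ = B (partialVec i) (partialVec j) k := by
        rw [Matrix.mulVec_mulVec, hinv, Matrix.one_mulVec]

/-- Reduces finding the connection to exhibiting a tensor `B` that solves the Koszul equation. -/
theorem IsRiemannianMetric.levi_eq {g : BilinField n} (hg : IsRiemannianMetric g)
    {p : Coord n} {B : Coord n →L[ℝ] Coord n →L[ℝ] Coord n}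
    (hB : ∀ v w u, 2 * g p (B v w) u
      = fderiv ℝ g p v w u + fderiv ℝ g p w v u - fderiv ℝ g p u v w) (X Y : VField n) :
    levi g X Y p = fderiv ℝ Y p (X p) + B (X p) (Y p) := by
  ext k
  simp only [levi, Pi.add_apply, hg.christoffel_eq hB]
  congr 1
  conv_rhs => rw [← sum_smul_partialVec (X p), ← sum_smul_partialVec (Y p)]
  simp only [map_sum, map_smul, _root_.sum_apply, _root_.smul_apply,
    Finset.sum_apply, Pi.smul_apply, smul_eq_mul, Finset.smul_sum]
  rw [Finset.sum_comm]
  exact Finset.sum_congr rfl fun i _ => Finset.sum_congr rfl fun j _ => by ring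

/-- The curvature of the connection `∇_X Y = D_X Y + B(X, Y)`. -/
theorem curv_eq_of_levi_eq {g : BilinField n} {B : Coord n → Coord n →L[ℝ] Coord n →L[ℝ] Coord n}
    (hB : ContDiff ℝ ∞ B)
    (h : ∀ (X Y : VField n) p, levi g X Y p = fderiv ℝ Y p (X p) + B p (X p) (Y p))
    {X Y Z : VField n} (hX : ContDiff ℝ ∞ X) (hY : ContDiff ℝ ∞ Y) (hZ : ContDiff ℝ ∞ Z)
    (p : Coord n) :
    curv g X Y Z p = fderiv ℝ B p (X p) (Y p) (Z p) - fderiv ℝ B p (Y p) (X p) (Z p)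
      + B p (X p) (B p (Y p) (Z p)) - B p (Y p) (B p (X p) (Z p)) := by
  have hZ1 : ContDiff ℝ ∞ (fderiv ℝ Z) := hZ.fderiv_right (by simp)
  have hZ2 : HasFDerivAt (fderiv ℝ Z) (fderiv ℝ (fderiv ℝ Z) p) p :=
    (hZ1.differentiable (by simp) p).hasFDerivAt
  have hd : ∀ {V : VField n}, ContDiff ℝ ∞ V → HasFDerivAt V (fderiv ℝ V p) p :=
    fun hV => (hV.differentiable (by simp) p).hasFDerivAt
  have hBd : HasFDerivAt B (fderiv ℝ B p) p := (hB.differentiable (by simp) p).hasFDerivAt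
  have key : ∀ {U V : VField n}, ContDiff ℝ ∞ V → levi g U (levi g V Z) p
      = fderiv ℝ (fderiv ℝ Z) p (U p) (V p) + fderiv ℝ Z p (fderiv ℝ V p (U p))
        + (fderiv ℝ B p (U p) (V p) (Z p) + B p (fderiv ℝ V p (U p)) (Z p)
          + B p (V p) (fderiv ℝ Z p (U p)))
        + B p (U p) (fderiv ℝ Z p (V p) + B p (V p) (Z p)) := by
    intro U V hV
    have e : levi g V Z = fun q => fderiv ℝ Z q (V q) + B q (V q) (Z q) := funext (h V Z)
    have hD := (hZ2.clm_apply (hd hV)).add ((hBd.clm_apply (hd hV)).clm_apply (hd hZ))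
    rw [h, e]
    erw [hD.fderiv]
    simp
    abel
  -- Symmetry removes the second derivatives of `Z`; the derivatives of `X` and `Y` cancel against
  -- the bracket term.
  have hs : fderiv ℝ (fderiv ℝ Z) p (X p) (Y p) = fderiv ℝ (fderiv ℝ Z) p (Y p) (X p) :=
    (hZ.contDiffAt.isSymmSndFDerivAt (by simp; exact WithTop.coe_le_coe.2 le_top)).eq _ _
  simp only [curv, Pi.sub_apply]
  rw [key hX, key hY, h, hs]
  simp only [VectorField.lieBracket, map_sub, map_add, _root_.sub_apply]
  abel

end General

/-! ### The metric, the contact form and the connection of `H(2,1)` -/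

section Heisenberg

theorem heisη_apply (p v : Coord 5) :
    heisη p v = (1 / 2) * (v 4 - p 0 * v 2 - p 1 * v 3) := by
  simp [heisη, dx]

theorem heisg_apply (p v w : Coord 5) :
    heisg p v w = (1 / 4) * (v 0 * w 0 + v 1 * w 1 + v 2 * w 2 + v 3 * w 3)
      + heisη p v * heisη p w := by
  simp [heisg, dx]
  ring

theorem heisφ_apply (θ : ℝ) (p v : Coord 5) :
    heisφ θ p v = ![-(Real.cos θ * v 2) - Real.sin θ * v 3,
      -(Real.sin θ * v 2) + Real.cos θ * v 3,
      Real.cos θ * v 0 + Real.sin θ * v 1,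
      Real.sin θ * v 0 - Real.cos θ * v 1,
      p 0 * (Real.cos θ * v 0 + Real.sin θ * v 1)
        + p 1 * (Real.sin θ * v 0 - Real.cos θ * v 1)] := by
  ext i
  fin_cases i <;>
    simp [heisφ, dx, heisX₁, heisX₂, heisY₁, heisY₂, partialVec] <;> ring

theorem contDiff_heisη : ContDiff ℝ ∞ heisη := by
  unfold heisη
  fun_prop

theorem contDiff_heisg : ContDiff ℝ ∞ heisg :=
  contDiff_const.add (contDiff_heisη.smulRight contDiff_heisη)

theorem contDiff_heisφ (θ : ℝ) : ContDiff ℝ ∞ (heisφ θ) := by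
  have h1 : ContDiff ℝ ∞ fun p => Real.cos θ • heisY₁ p + Real.sin θ • heisY₂ p := by
    unfold heisY₁ heisY₂
    fun_prop
  have h2 : ContDiff ℝ ∞ fun p => Real.sin θ • heisY₁ p - Real.cos θ • heisY₂ p := by
    unfold heisY₁ heisY₂
    fun_prop
  have h3 : ContDiff ℝ ∞ fun p => -(Real.cos θ • heisX₁ p) - Real.sin θ • heisX₂ p := by
    unfold heisX₁ heisX₂
    fun_prop
  have h4 : ContDiff ℝ ∞ fun p => -(Real.sin θ • heisX₁ p) + Real.cos θ • heisX₂ p := by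
    unfold heisX₁ heisX₂
    fun_prop
  exact (((contDiff_const.smulRight h1).add (contDiff_const.smulRight h2)).add
    (contDiff_const.smulRight h3)).add (contDiff_const.smulRight h4)

theorem fderiv_heisη (p v w : Coord 5) :
    fderiv ℝ heisη p v w = -(1 / 2) * (v 0 * w 2 + v 1 * w 3) := by
  rw [fderiv_eq_of_quadratic (b := (-(1 / 2) : ℝ) • (v 0 • dx 2 + v 1 • dx 3)) (c := 0)
    (contDiff_heisη.differentiable (by simp) p)]
  · simp [dx]
    ring
  · intro t
    ext w
    simp [heisη, dx]
    ring

theorem extD_heisη (p v w : Coord 5) :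
    extD heisη p v w
      = -(1 / 2) * (v 0 * w 2 - w 0 * v 2 + v 1 * w 3 - w 1 * v 3) := by
  simp only [extD, fderiv_heisη]
  ring

/-- Only the summand `η ⊗ η` varies with the point, so this is the product rule. -/
theorem fderiv_heisg (p x v w : Coord 5) :
    fderiv ℝ heisg p x v w
      = fderiv ℝ heisη p x v * heisη p w + heisη p v * fderiv ℝ heisη p x w := by
  have hη := (contDiff_heisη.differentiable (by simp) p).hasFDerivAt
  have h : HasFDerivAt (fun q => heisg q v w)
      (heisη p v • (fderiv ℝ heisη p).flip w + heisη p w • (fderiv ℝ heisη p).flip v) p := by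
    simp only [heisg_apply]
    have hv : ∀ v, HasFDerivAt (fun q => heisη q v) ((fderiv ℝ heisη p).flip v) p := fun v =>
      (hη.clm_apply (hasFDerivAt_const v p)).congr_fderiv (by simp)
    exact ((hv v).mul (hv w)).const_add _
  have h' : HasFDerivAt (fun q => heisg q v w) _ p :=
    (((contDiff_heisg.differentiable (by simp) p).hasFDerivAt).clm_apply
      (hasFDerivAt_const v p)).clm_apply (hasFDerivAt_const w p)
  have e := congrArg (fun L => L x) (h'.unique h)
  simp at e
  rw [e]
  ring

theorem heisη_ξ (p : Coord 5) : heisη p (heisξ p) = 1 := by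
  simp [heisη_apply, heisξ, partialVec]

theorem isRiemannianMetric_heisg : IsRiemannianMetric heisg where
  smooth := contDiff_heisg
  symm p v w := by simp only [heisg_apply]; ring
  pos p v hv := by
    by_contra hle
    rw [heisg_apply] at hle
    apply hv
    have s0 := sq_nonneg (v 0)
    have s1 := sq_nonneg (v 1)
    have s2 := sq_nonneg (v 2)
    have s3 := sq_nonneg (v 3)
    have s4 := sq_nonneg (heisη p v)
    have h0 : v 0 = 0 := by nlinarith
    have h1 : v 1 = 0 := by nlinarith
    have h2 : v 2 = 0 := by nlinarith
    have h3 : v 3 = 0 := by nlinarith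
    have h4 : heisη p v = 0 := by nlinarith
    have h5 : v 4 = 0 := by simpa [heisη_apply, h2, h3] using h4
    ext i
    fin_cases i <;> simp [*]

/-- The endomorphism `J` with `g(J v, w) = dη(v, w)` up to normalisation. -/
noncomputable def heisJ : EndField 5 := fun p =>
  (dx 2).smulRight (partialVec 0) + (dx 3).smulRight (partialVec 1)
    - (dx 0).smulRight (partialVec 2 + p 0 • partialVec 4)
    - (dx 1).smulRight (partialVec 3 + p 1 • partialVec 4)

/-- The field `(v, w) ↦ η(w) J v`. -/
noncomputable def heisJη : Coord 5 → Coord 5 →L[ℝ] Coord 5 →L[ℝ] Coord 5 := fun p =>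
  (dx 2).smulRight ((heisη p).smulRight (partialVec 0))
    + (dx 3).smulRight ((heisη p).smulRight (partialVec 1))
    - (dx 0).smulRight ((heisη p).smulRight (partialVec 2 + p 0 • partialVec 4))
    - (dx 1).smulRight ((heisη p).smulRight (partialVec 3 + p 1 • partialVec 4))

/-- The symmetric part of the flat derivative of `-2η`, times `∂/∂z`. -/
noncomputable def heisSymm : Coord 5 →L[ℝ] Coord 5 →L[ℝ] Coord 5 :=
  (1 / 2 : ℝ) • ((dx 0).smulRight ((dx 2).smulRight (partialVec 4))
    + (dx 2).smulRight ((dx 0).smulRight (partialVec 4))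
    + (dx 1).smulRight ((dx 3).smulRight (partialVec 4))
    + (dx 3).smulRight ((dx 1).smulRight (partialVec 4)))

/-- The difference `∇ - D` of the Levi-Civita connection of `heisg` and the flat connection. -/
noncomputable def heisConn : Coord 5 → Coord 5 →L[ℝ] Coord 5 →L[ℝ] Coord 5 := fun p =>
  (heisη p).smulRight (heisJ p) + heisJη p - heisSymm

theorem heisConn_apply (p v w : Coord 5) :
    heisConn p v w = ![heisη p v * w 2 + heisη p w * v 2, heisη p v * w 3 + heisη p w * v 3,
      -(heisη p v * w 0 + heisη p w * v 0), -(heisη p v * w 1 + heisη p w * v 1),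
      -(p 0 * (heisη p v * w 0 + heisη p w * v 0)) - p 1 * (heisη p v * w 1 + heisη p w * v 1)
        - 1 / 2 * (v 0 * w 2 + v 2 * w 0 + v 1 * w 3 + v 3 * w 1)] := by
  ext i
  fin_cases i <;> simp [heisConn, heisJ, heisJη, heisSymm, dx, partialVec] <;> ring

theorem contDiff_heisConn : ContDiff ℝ ∞ heisConn := by
  have h0 : ContDiff ℝ ∞ fun p : Coord 5 =>
      (partialVec 2 + p 0 • partialVec 4 : Coord 5) := by fun_prop
  have h1 : ContDiff ℝ ∞ fun p : Coord 5 =>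
      (partialVec 3 + p 1 • partialVec 4 : Coord 5) := by fun_prop
  have hJ : ContDiff ℝ ∞ heisJ :=
    (contDiff_const.sub (contDiff_const.smulRight h0)).sub (contDiff_const.smulRight h1)
  have hη := contDiff_heisη
  have hJη : ContDiff ℝ ∞ heisJη :=
    (((contDiff_const.smulRight (hη.smulRight contDiff_const)).add
      (contDiff_const.smulRight (hη.smulRight contDiff_const))).sub
      (contDiff_const.smulRight (hη.smulRight h0))).sub
      (contDiff_const.smulRight (hη.smulRight h1))
  exact ((hη.smulRight hJ).add hJη).sub contDiff_const

/-- For this metric the right side is `η(w) Ω(v,u) + η(v) Ω(w,u) + (D_vη(w) + D_wη(v)) η(u)`. As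
`Ω(v,u) = 2g(Jv,u)` and `η(u) = g(ξ,u)`, one reads off `η(v)Jw + η(w)Jv` plus a multiple of `ξ`. -/
theorem heisConn_koszul (p v w u : Coord 5) :
    2 * heisg p (heisConn p v w) u
      = fderiv ℝ heisg p v w u + fderiv ℝ heisg p w v u - fderiv ℝ heisg p u v w := by
  simp only [fderiv_heisg, fderiv_heisη, heisg_apply, heisη_apply, heisConn_apply]
  simp
  ring

theorem fderiv_heisConn (p x v w : Coord 5) :
    fderiv ℝ heisConn p x v w
      = ![fderiv ℝ heisη p x v * w 2 + fderiv ℝ heisη p x w * v 2,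
        fderiv ℝ heisη p x v * w 3 + fderiv ℝ heisη p x w * v 3,
        -(fderiv ℝ heisη p x v * w 0 + fderiv ℝ heisη p x w * v 0),
        -(fderiv ℝ heisη p x v * w 1 + fderiv ℝ heisη p x w * v 1),
        -(x 0 * (heisη p v * w 0 + heisη p w * v 0)) - x 1 * (heisη p v * w 1 + heisη p w * v 1)
        - p 0 * (fderiv ℝ heisη p x v * w 0 + fderiv ℝ heisη p x w * v 0)
        - p 1 * (fderiv ℝ heisη p x v * w 1 + fderiv ℝ heisη p x w * v 1)] := by
  have h : HasFDerivAt (fun q => heisConn q v w) _ p :=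
    (((contDiff_heisConn.differentiable (by simp) p).hasFDerivAt).clm_apply
      (hasFDerivAt_const v p)).clm_apply (hasFDerivAt_const w p)
  have e : fderiv ℝ (fun q => heisConn q v w) p x = fderiv ℝ heisConn p x v w := by
    rw [h.fderiv]
    simp
  rw [← e]
  -- The quadratic term comes from the `z`-component alone, where a coordinate of `p` multiplies the
  -- affine function `η`.
  refine fderiv_eq_of_quadratic (c := ![0, 0, 0, 0,
    -(x 0 * (fderiv ℝ heisη p x v * w 0 + fderiv ℝ heisη p x w * v 0))
      - x 1 * (fderiv ℝ heisη p x v * w 1 + fderiv ℝ heisη p x w * v 1)]) h.differentiableAt ?_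
  intro t
  simp only [heisConn_apply, heisη_apply, fderiv_heisη]
  ext i
  fin_cases i <;> simp <;> ring

/-- The curvature tensor of `heisg`. -/
theorem riem_heisg {X Y Z : VField 5} (hX : ContDiff ℝ ∞ X) (hY : ContDiff ℝ ∞ Y)
    (hZ : ContDiff ℝ ∞ Z) (W : VField 5) (p : Coord 5) :
    riem heisg X Y Z W p =
      -(2 * extD heisη p (X p) (Y p) * extD heisη p (Z p) (W p)
        + extD heisη p (X p) (Z p) * extD heisη p (Y p) (W p)
        - extD heisη p (Y p) (Z p) * extD heisη p (X p) (W p)) / 4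
      - (heisη p (X p) * heisη p (W p) * heisg p (Y p) (Z p)
        + heisη p (Y p) * heisη p (Z p) * heisg p (X p) (W p)
        - heisη p (Y p) * heisη p (W p) * heisg p (X p) (Z p)
        - heisη p (X p) * heisη p (Z p) * heisg p (Y p) (W p)) := by
  have hL := fun X Y p => isRiemannianMetric_heisg.levi_eq (heisConn_koszul p) X Y
  rw [riem, curv_eq_of_levi_eq contDiff_heisConn hL hX hY hZ]
  -- No derivatives of the fields remain, so the claim is a polynomial identity in vectors at `p`.
  generalize X p = x
  generalize Y p = y
  generalize Z p = z
  generalize W p = w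
  simp only [fderiv_heisConn, heisConn_apply, heisg_apply, fderiv_heisη, extD_heisη, heisη_apply]
  simp
  ring

/-! ### The almost contact metric structure of `H(2,1)` -/

theorem leftTranslation_apply (a : H21) (p : Coord 5) :
    leftTranslation a p = ![heisCoord a 0 + p 0, heisCoord a 1 + p 1, heisCoord a 2 + p 2,
      heisCoord a 3 + p 3, heisCoord a 4 + p 4 + heisCoord a 0 * p 2 + heisCoord a 1 * p 3] := by
  obtain ⟨q, rfl⟩ := heisCoord.symm.surjective a
  rw [Equiv.apply_symm_apply, leftTranslation, ← Equiv.eq_symm_apply]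
  exact Subtype.ext (Units.ext (heisMatrix_mul q p))

theorem fderiv_leftTranslation (a : H21) (p v : Coord 5) :
    fderiv ℝ (leftTranslation a) p v = ![v 0, v 1, v 2, v 3,
      v 4 + heisCoord a 0 * v 2 + heisCoord a 1 * v 3] := by
  refine fderiv_eq_of_quadratic (c := 0) ?_ fun t => ?_
  · rw [funext (leftTranslation_apply a), differentiableAt_pi]
    intro i
    fin_cases i <;> simp <;> fun_prop
  · simp only [leftTranslation_apply]
    ext i
    fin_cases i <;> simp <;> ring

/-- The forms `dxⁱ`, `dyⁱ` and `η` are each left invariant: in `η` the shift of `xⁱ` cancels the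
extra `dyⁱ` terms from `dz`. -/
theorem isLeftInvariantMetric_heisg : IsLeftInvariantMetric heisg := by
  intro a p v w
  simp only [fderiv_leftTranslation, heisg_apply, heisη_apply, leftTranslation_apply]
  simp
  ring

theorem heisStructure_isAlmostContactMetric (θ : ℝ) :
    (heisStructure θ).IsAlmostContactMetric where
  smooth_φ := contDiff_heisφ θ
  smooth_ξ := contDiff_const
  smooth_η := contDiff_heisη
  metric := isRiemannianMetric_heisg
  phi_sq p v := by
    have h := Real.cos_sq_add_sin_sq θ
    simp only [heisStructure, heisφ_apply, heisη_apply, heisξ, partialVec]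
    ext i
    fin_cases i
    · simp
      linear_combination (-v 0) * h
    · simp
      linear_combination (-v 1) * h
    · simp
      linear_combination (-v 2) * h
    · simp
      linear_combination (-v 3) * h
    · simp
      linear_combination (-(p 0 * v 2) - p 1 * v 3) * h
  eta_xi := heisη_ξ
  compat p v w := by
    have h := Real.cos_sq_add_sin_sq θ
    simp only [heisStructure, heisφ_apply, heisg_apply, heisη_apply]
    simp
    linear_combination (v 0 * w 0 + v 1 * w 1 + v 2 * w 2 + v 3 * w 3) * h

/-! ### Contact form, Killing field and failure of the Sasakian condition -/

/-- The values of `dη` on the frame `∂/∂z, X₁/2, Y₁/2, X₂/2, Y₂/2`, up to a factor `-2`. -/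
def frameExtD : Matrix (Fin 5) (Fin 5) ℤ :=
  !![0, 0, 0, 0, 0;
     0, 0, 1, 0, 0;
     0, -1, 0, 0, 0;
     0, 0, 0, 0, 1;
     0, 0, 0, -1, 0]

/-- The values of `2η` on the same frame. -/
def frameEta : Fin 5 → ℤ := ![1, 0, 0, 0, 0]

/-- Integer entries make the sum decidable. Its nonzero terms fix `0` and preserve or exchange the
planes `{1,2}` and `{3,4}`; all eight equal `+1`. -/
theorem frame_sum_ne_zero : ∑ σ : Equiv.Perm (Fin 5), (Equiv.Perm.sign σ : ℤ) *
    (frameEta (σ 0) * (frameExtD (σ 1) (σ 2) * frameExtD (σ 3) (σ 4))) ≠ 0 := by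
  decide +kernel

theorem isContactForm_heisη : IsContactForm heisη := by
  refine ⟨contDiff_heisη, 2, rfl, fun p => ⟨![![0, 0, 0, 0, 1], ![1, 0, 0, 0, 0],
    ![0, 0, 1, 0, p 0], ![0, 1, 0, 0, 0], ![0, 0, 0, 1, p 1]], ?_⟩⟩
  set v : Fin 5 → Coord 5 := ![![0, 0, 0, 0, 1], ![1, 0, 0, 0, 0],
    ![0, 0, 1, 0, p 0], ![0, 1, 0, 0, 0], ![0, 0, 0, 1, p 1]] with hv
  have h1 : ∀ i, heisη p (v i) = 1 / 2 * (frameEta i : ℝ) := by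
    intro i
    fin_cases i <;> simp [hv, heisη_apply, frameEta]
  have h2 : ∀ i j, extD heisη p (v i) (v j) = -(1 / 2) * (frameExtD i j : ℝ) := by
    intro i j
    fin_cases i <;> fin_cases j <;> simp [hv, extD_heisη, frameExtD]
  have h3 : contactVolume heisη 2 p v = 1 / 8 * ((∑ σ : Equiv.Perm (Fin 5),
      (Equiv.Perm.sign σ : ℤ) * (frameEta (σ 0) *
        (frameExtD (σ 1) (σ 2) * frameExtD (σ 3) (σ 4))) : ℤ) : ℝ) := by
    rw [contactVolume, Int.cast_sum, Finset.mul_sum]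
    refine Finset.sum_congr rfl fun σ _ => ?_
    rw [Fin.prod_univ_two]
    change _ * (heisη p (v (σ 0)) * (extD heisη p (v (σ 1)) (v (σ 2)) *
      extD heisη p (v (σ 3)) (v (σ 4)))) = _
    rw [h1, h2, h2]
    push_cast
    ring
  rw [h3]
  exact mul_ne_zero (by norm_num) (Int.cast_ne_zero.2 frame_sum_ne_zero)

/-- `ξ` is constant in the coordinates and the coefficients of `g` do not depend on `z`. -/
theorem isKilling_heisξ : IsKilling heisg heisξ := by
  intro X Y hX hY p
  have hd : ∀ {V : VField 5}, ContDiff ℝ ∞ V → HasFDerivAt V (fderiv ℝ V p) p :=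
    fun hV => (hV.differentiable (by simp) p).hasFDerivAt
  have hg := (contDiff_heisg.differentiable (by simp) p).hasFDerivAt
  have hξ : fderiv ℝ heisξ p = 0 := fderiv_const_apply _
  have h0 : ∀ v w, fderiv ℝ heisg p (heisξ p) v w = 0 := by
    intro v w
    simp [fderiv_heisg, fderiv_heisη, heisξ, partialVec]
  have h : HasFDerivAt (fun q => heisg q (X q) (Y q)) _ p :=
    (hg.clm_apply (hd hX)).clm_apply (hd hY)
  rw [h.fderiv]
  simp [VectorField.lieBracket, hξ, h0]

theorem heisStructure_isKContact (θ : ℝ) : (heisStructure θ).IsKContact where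
  almostContactMetric := heisStructure_isAlmostContactMetric θ
  contact := isContactForm_heisη
  reeb p v := by simp [heisStructure, extD_heisη, heisξ, partialVec]
  killing := isKilling_heisξ

/-- The condition `dη = g(·, φ ·)` fails on `(X₁, Y₁)` or on `(X₂, Y₂)`. -/
theorem heisStructure_not_isSasakian (θ : ℝ) : ¬ (heisStructure θ).IsSasakian := by
  rintro ⟨⟨-, h⟩, -⟩
  -- The two pairs give `cos θ = 1` and `cos θ = -1`.
  have h1 := h 0 ![1, 0, 0, 0, 0] ![0, 0, 1, 0, 0]
  have h2 := h 0 ![0, 1, 0, 0, 0] ![0, 0, 0, 1, 0]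
  simp [heisStructure, extD_heisη, heisφ_apply, heisg_apply, heisη_apply] at h1 h2
  linarith

/-! ### The curvature identities (G2) and (G1) -/

theorem contDiff_phi (θ : ℝ) {X : VField 5} (hX : ContDiff ℝ ∞ X) :
    ContDiff ℝ ∞ ((heisStructure θ).phi X) :=
  (contDiff_heisφ θ).clm_apply hX

theorem heisη_heisφ (θ : ℝ) (p v : Coord 5) : heisη p (heisφ θ p v) = 0 := by
  rw [heisη_apply, heisφ_apply]
  simp

/-- This is the symmetry of `S`. -/
theorem extD_heisφ_left (θ : ℝ) (p v w : Coord 5) :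
    extD heisη p (heisφ θ p v) w = -extD heisη p v (heisφ θ p w) := by
  simp only [extD_heisη, heisφ_apply]
  simp
  ring

/-- Follows from skewness, `φ² = -I + η ⊗ ξ` and `i_ξ dη = 0`. -/
theorem extD_heisφ_heisφ (θ : ℝ) (p v w : Coord 5) :
    extD heisη p (heisφ θ p v) (heisφ θ p w) = extD heisη p v w := by
  have h := (heisStructure_isAlmostContactMetric θ).phi_sq p w
  change heisφ θ p (heisφ θ p w) = -w + heisη p w • heisξ p at h
  rw [extD_heisφ_left, h]
  simp [extD_heisη, heisξ, partialVec]
  ring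

theorem heisStructure_G2 (θ : ℝ) : (heisStructure θ).G2 := by
  intro X Y Z W hX hY hZ hW p
  have hφX := contDiff_phi θ hX
  have hφY := contDiff_phi θ hY
  have hφZ := contDiff_phi θ hZ
  change riem heisg X Y Z W p = riem heisg _ Y Z _ p + riem heisg X _ Z _ p
    + riem heisg X Y _ _ p + heisg p (X p) (Z p) * heisη p (W p) * heisη p (Y p)
    - heisg p (Z p) (Y p) * heisη p (X p) * heisη p (W p)
  rw [riem_heisg hX hY hZ, riem_heisg hφX hY hZ, riem_heisg hX hφY hZ, riem_heisg hX hY hφZ]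
  have e : ∀ V : VField 5, (heisStructure θ).phi V p = heisφ θ p (V p) := fun _ => rfl
  simp only [e, heisη_heisφ]
  generalize X p = x
  generalize Y p = y
  generalize Z p = z
  generalize W p = w
  have hg : ∀ v w, heisg p (heisφ θ p v) (heisφ θ p w) = heisg p v w - heisη p v * heisη p w :=
    (heisStructure_isAlmostContactMetric θ).compat p
  -- Skewness makes the `Ω`-products with a single `φ` in each factor cancel in pairs; the others
  -- rebuild the `Ω`-part of `R(X,Y,Z,W)`. Since `η ∘ φ = 0`, the terms with `η(W)` are lost, and
  -- the explicit correction in (G2) restores them.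
  simp only [extD_heisφ_heisφ, hg]
  rw [extD_heisφ_left θ p x y, extD_heisφ_left θ p x z, extD_heisφ_left θ p y z,
    isRiemannianMetric_heisg.symm p z y]
  ring

theorem heisStructure_not_G1 (θ : ℝ) : ¬ (heisStructure θ).G1 := by
  intro h
  have hc : ∀ v : Coord 5, ContDiff ℝ ∞ (fun _ : Coord 5 => v) := fun v => contDiff_const
  -- With `X, Y` spanning the `y`-plane and `Z, W` the `x`-plane, the right side is `det S / 16 =
  -- -1/16`, while the left side is `1/16`.
  have h1 := h (fun _ => ![0, 0, 1, 0, 0]) (fun _ => ![0, 0, 0, 1, 0])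
    (fun _ => ![1, 0, 0, 0, 0]) (fun _ => ![0, 1, 0, 0, 0]) (hc _) (hc _) (hc _) (hc _) 0
  change riem heisg _ _ _ _ 0 - riem heisg _ _ _ _ 0 = _ at h1
  rw [riem_heisg (hc _) (hc _) (contDiff_phi θ (hc _)), riem_heisg (hc _) (hc _) (hc _)] at h1
  have hs := Real.cos_sq_add_sin_sq θ
  simp [heisStructure, ContactData.phi, extD_heisη, heisφ_apply, heisg_apply, heisη_apply] at h1
  nlinarith

end Heisenberg

theorem mainTheorem9 (θ : ℝ) :
    IsLeftInvariantMetric heisg ∧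
    (heisStructure θ).IsAlmostContactMetric ∧
    (heisStructure θ).IsKContact ∧
    ¬ (heisStructure θ).IsSasakian ∧
    (heisStructure θ).G2 ∧
    ¬ (heisStructure θ).G1 :=
  ⟨isLeftInvariantMetric_heisg, heisStructure_isAlmostContactMetric θ, heisStructure_isKContact θ,
    heisStructure_not_isSasakian θ, heisStructure_G2 θ, heisStructure_not_G1 θ⟩
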